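/- Let $n\in\mathbb N$, $\mathbb R[X]=\mathbb R[X_1,\dots,X_n]$, and let $\mathbb R_{\ge0}[X]$ be the set of polynomials with nonnegative coefficients. Let $0\neq g\in\mathbb R_{\ge 0}[X]$, let $\mathbb R[X]_g=\mathbb R[X,\tfrac1g]=\{f/g^k\mid f\in\mathbb R[X],\,k\in\mathbb N\}\subset\mathbb R(X)$, and let $T_g\subset\mathbb R[X]_g$ be the semiring generated by $\mathbb R_{\ge0}[X]$ and $\tfrac1g$, i.e. the smallest subset of $\mathbb R[X]_g$ containing $\mathbb R_{\ge 0}[X]\cup\{\tfrac1g\}$ and closed under addition and multiplication. Let $$A(g)=\{a\in\mathbb R[X]_g\mid N+a\in T_g\text{ and }N-a\in T_g\text{ for some }N\in\mathbb N\}$$ be the subring of $T_g$-bounded elements, and put $T(g)=T_g\cap A(g)$. Let $S(T(g))$ be the set of all ring homomorphisms $x:A(g)\to\mathbb R$ with $x(T(g))\subset[0,\infty)$, and write $a(x):=x(a)$ for $a\in A(g)$. Since $g>0$ on $(0,\infty)^n$, every $a=f/g^k\in\mathbb R[X]_g$ has a well-defined value $a(p)=f(p)/g(p)^k$ at each $p\in(0,\infty)^n$.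 Corollary 4.2 (Handelman). For every $x\in S(T(g))$ there are $w\in\mathbb R^n$ and $y\in(0,\infty)^n$ such that, for all $a\in A(g)$, the following limit exists and $$a(x)=\lim_{t\to\infty}a(e^{tw_1}y_1,\dots,e^{tw_n}y_n).$$ -/

import Mathlib

open Filter Topology

noncomputable section

/-- The semiring `ℝ≥0[X₁, …, Xₙ]` of polynomials all of whose coefficients are nonnegative, as a
subset of `ℝ[X₁, …, Xₙ]`. -/
def nonnegPoly (n : ℕ) : Subsemiring (MvPolynomial (Fin n) ℝ) where
  carrier := {p | ∀ m, 0 ≤ p.coeff m}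
  zero_mem' := fun m => by simp
  one_mem' := fun m => by
    rw [MvPolynomial.coeff_one]
    split_ifs <;> norm_num
  add_mem' := fun {p q} hp hq m => by
    rw [MvPolynomial.coeff_add]
    exact add_nonneg (hp m) (hq m)
  mul_mem' := fun {p q} hp hq m => by
    classical
    rw [MvPolynomial.coeff_mul]
    exact Finset.sum_nonneg fun x _ => mul_nonneg (hp x.1) (hq x.2)

/-- For a semiring `T` of a commutative ring `A`, the ring
`O_T(A) = {a ∈ A | N ± a ∈ T for some N ∈ ℕ}` of `T`-bounded elements of `A`. -/
def boundedSubring {A : Type*} [CommRing A] (T : Subsemiring A) : Subring A where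
  carrier := {a | ∃ N : ℕ, (N : A) + a ∈ T ∧ (N : A) - a ∈ T}
  zero_mem' := ⟨0, by simp, by simp⟩
  one_mem' := ⟨1, by
    rw [Nat.cast_one]
    exact T.add_mem T.one_mem T.one_mem, by simp⟩
  neg_mem' := by
    rintro a ⟨N, h1, h2⟩
    exact ⟨N, by rwa [← sub_eq_add_neg], by rwa [sub_neg_eq_add]⟩
  add_mem' := by
    rintro a b ⟨N, h1, h2⟩ ⟨M, h3, h4⟩
    refine ⟨N + M, ?_, ?_⟩
    · convert T.add_mem h1 h3 using 1
      push_cast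
      ring
    · convert T.add_mem h2 h4 using 1
      push_cast
      ring
  mul_mem' := by
    rintro a b ⟨N, h1, h2⟩ ⟨M, h3, h4⟩
    have hN : (N : A) ∈ T := natCast_mem T N
    have hM : (M : A) ∈ T := natCast_mem T M
    refine ⟨3 * N * M, ?_, ?_⟩
    · convert T.add_mem (T.add_mem (T.mul_mem h1 h3) (T.mul_mem hM h2)) (T.mul_mem hN h4) using 1
      push_cast
      ring
    · convert T.add_mem (T.add_mem (T.mul_mem h2 h3) (T.mul_mem hM h1)) (T.mul_mem hN h4) using 1
      push_cast
      ring

/-- For a semiring `T` of a commutative ring `A`, the set `S(T)` of all ring homomorphisms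
`φ : A → ℝ` with `φ(T) ⊆ [0, ∞)`. -/
def realPoints {A : Type*} [CommRing A] (T : Subsemiring A) : Set (A →+* ℝ) :=
  {φ | ∀ t ∈ T, 0 ≤ φ t}

section Handelman

variable {n : ℕ} (g : MvPolynomial (Fin n) ℝ)

/-- The semiring `T_g` of `ℝ[X, 1/g]` generated by `ℝ≥0[X]` and `1/g`. -/
def semiringAway : Subsemiring (Localization.Away g) :=
  Subsemiring.closure
    (algebraMap (MvPolynomial (Fin n) ℝ) (Localization.Away g) '' (nonnegPoly n : Set _) ∪
      {IsLocalization.Away.invSelf g})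

/-- The ring `A(g)` of `T_g`-bounded elements of `ℝ[X, 1/g]`. -/
def handelmanRing : Subring (Localization.Away g) :=
  boundedSubring (semiringAway g)

/-- The semiring `T(g) = T_g ∩ A(g)` of the ring `A(g)`. -/
def handelmanSemiring : Subsemiring (handelmanRing g) :=
  (semiringAway g).comap (handelmanRing g).subtype

variable {g}

theorem eval_pos_of_nonnegPoly (hg : g ∈ nonnegPoly n) (hg0 : g ≠ 0) {p : Fin n → ℝ}
    (hp : ∀ i, 0 < p i) : 0 < MvPolynomial.eval p g := by
  rw [MvPolynomial.eval_eq]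
  refine Finset.sum_pos (fun m hm => mul_pos ?_ (Finset.prod_pos fun i _ => pow_pos (hp i) _)) ?_
  · exact lt_of_le_of_ne (hg m) (Ne.symm (MvPolynomial.mem_support_iff.mp hm))
  · exact Finset.nonempty_iff_ne_empty.mpr fun h => hg0 (MvPolynomial.support_eq_empty.mp h)

/-- Evaluation `f / g ^ k ↦ f(p) / g(p) ^ k` of the elements of `ℝ[X, 1/g]` at a point `p` of the
open positive orthant, for a nonzero `g` with nonnegative coefficients (so that `g(p) > 0`). -/
def evalAway (hg : g ∈ nonnegPoly n) (hg0 : g ≠ 0) (p : Fin n → ℝ) (hp : ∀ i, 0 < p i) :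
    Localization.Away g →+* ℝ :=
  IsLocalization.Away.lift (S := Localization.Away g) g (g := MvPolynomial.eval p)
    (eval_pos_of_nonnegPoly hg hg0 hp).ne'.isUnit

end Handelman

end

/-!
The ring `A(g)` is generated over `ℝ` by the quotients `X ^ m / g`, where `m` runs through the
support of `g` (`handelmanRing_le_closure`): if `N + a` and `N - a` are both of the form
`fᵢ / g ^ k` with `fᵢ` having nonnegative coefficients, then `f₁ + f₂ = 2 N g ^ k` forces every
monomial of `f₁` to occur in `g ^ k`, hence to be a product of `k` monomials of `g`. A point `x` is
therefore determined by the numbers `z m = x (X ^ m / g)`. They are nonnegative, satisfy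
`∑ gₘ z m = 1`, and satisfy one binomial equation for every affine relation with integer
coefficients between the exponents `m` (`prod_map_monomialDiv_eq`).

The binomial equations say that the exponents with `z m ≠ 0` are those on a face of the Newton
polytope of `g`, and that on this face `log z` is an affine function of the exponent
(`exists_face_of_binomial`). Both facts are linear algebra over `ℚ`. The face is obtained from
Gordan's alternative `exists_dual_forall_pos`: the obstruction to a supporting functional would be
a relation, integral after clearing denominators, whose binomial equation has exactly one
vanishing side. The affine function is obtained by viewing `ℝ` as a `ℚ`-vector space and extending
a `ℚ`-linear map.

Take `w` to be the direction exposing the face and `log y` to be the linear part of the affine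
function. Up to a common factor, the monomial `X ^ m` on the curve `e ^ {t w} y` is then constantly
`z m` when `m` lies on the face and decays exponentially otherwise, so `X ^ m / g` tends to `z m`
(`tendsto_evalAway_monomialDiv`). Limits respect sums and products, so the generators suffice.
-/

/-! ### Rational linear algebra -/

/-- Gordan's alternative over an ordered field: if finitely many vectors admit no nontrivial
relation with nonnegative coefficients, then some linear functional is positive on all of them.

In the induction on the number of vectors, a new vector `v` is divided out. If the other vectors
still satisfy the hypothesis modulo `v`, a large multiple of a functional vanishing on `v` is
added to one that is positive on `v`; otherwise a positive multiple of `v` lies in the cone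
spanned by the others. -/
theorem exists_dual_forall_pos {K : Type*} [Field K] [LinearOrder K] [IsStrictOrderedRing K]
    {ι : Type*} (s : Finset ι) {V : Type*} [AddCommGroup V] [Module K V] (e : ι → V)
    (h : ∀ c : ι → K, (∀ i ∈ s, 0 ≤ c i) → ∑ i ∈ s, c i • e i = 0 → ∀ i ∈ s, c i = 0) :
    ∃ f : V →ₗ[K] K, ∀ i ∈ s, 0 < f (e i) := by
  classical
  induction s using Finset.induction_on generalizing V with
  | empty => exact ⟨0, by simp⟩
  | insert j s hj ih =>
    have key : ∀ (c : ι → K) (d : K), (∀ i ∈ s, 0 ≤ c i) → 0 ≤ d →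
        ∑ i ∈ s, c i • e i + d • e j = 0 → d = 0 ∧ ∀ i ∈ s, c i = 0 := by
      intro c d hc hd hsum
      have hne : ∀ i ∈ s, i ≠ j := fun i hi hij => hj (hij ▸ hi)
      have hupd : ∀ i ∈ s, Function.update c j d i = c i := fun i hi => by simp [hne i hi]
      have := h (Function.update c j d) ?_ ?_
      · refine ⟨by simpa using this j (Finset.mem_insert_self _ _), fun i hi => ?_⟩
        rw [← hupd i hi]
        exact this i (Finset.mem_insert_of_mem hi)
      · intro i hi
        rcases Finset.mem_insert.mp hi with rfl | hi
        · simpa using hd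
        · rw [hupd i hi]
          exact hc i hi
      · rw [Finset.sum_insert hj, Finset.sum_congr rfl fun i hi => by rw [hupd i hi],
          Function.update_self, add_comm]
        exact hsum
    by_cases H : ∀ c : ι → K, (∀ i ∈ s, 0 ≤ c i) →
        ∑ i ∈ s, c i • (K ∙ e j).mkQ (e i) = 0 → ∀ i ∈ s, c i = 0
    · obtain ⟨f, hf⟩ := ih _ H
      have hej : e j ∉ (⊥ : Submodule K V) := fun h0 => by
        rw [Submodule.mem_bot] at h0
        have := (key 0 1 (by simp) zero_le_one (by simp [h0])).1
        exact one_ne_zero this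
      obtain ⟨φ, hφ, -⟩ := Submodule.exists_le_ker_of_notMem hej
      set ψ : V →ₗ[K] K := φ (e j) • φ with hψ
      have hψj : 0 < ψ (e j) := by
        exact mul_self_pos.mpr hφ
      set N : K := ∑ i ∈ s, |ψ (e i)| / f ((K ∙ e j).mkQ (e i)) + 1 with hN
      refine ⟨N • (f ∘ₗ (K ∙ e j).mkQ) + ψ, fun i hi => ?_⟩
      rcases Finset.mem_insert.mp hi with hij | hi
      · rw [hij]
        have h0 : (K ∙ e j).mkQ (e j) = 0 :=
          (Submodule.Quotient.mk_eq_zero _).mpr (Submodule.mem_span_singleton_self _)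
        rw [LinearMap.add_apply, LinearMap.smul_apply, LinearMap.comp_apply, h0]
        simpa using hψj
      · have hfi := hf i hi
        have h1 : |ψ (e i)| / f ((K ∙ e j).mkQ (e i)) < N := by
          have := Finset.single_le_sum (f := fun i => |ψ (e i)| / f ((K ∙ e j).mkQ (e i)))
            (fun k hk => div_nonneg (abs_nonneg _) (hf k hk).le) hi
          linarith
        rw [div_lt_iff₀ hfi] at h1
        rw [LinearMap.add_apply, LinearMap.smul_apply, LinearMap.comp_apply, smul_eq_mul]
        linarith [neg_abs_le (ψ (e i))]
    · push Not at H
      obtain ⟨c, hc, hsum, i₀, hi₀, hci₀⟩ := H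
      obtain ⟨d, hd⟩ : ∃ d : K, d • e j = ∑ i ∈ s, c i • e i := by
        rw [← Submodule.mem_span_singleton, ← Submodule.Quotient.mk_eq_zero,
          ← Submodule.mkQ_apply, map_sum]
        simpa only [map_smul] using hsum
      have hdpos : 0 < d := by
        by_contra hneg
        refine hci₀ ((key c (-d) hc (by linarith) ?_).2 i₀ hi₀)
        rw [← hd, neg_smul, add_neg_cancel]
      obtain ⟨f, hf⟩ := ih e fun c hc hs => (key c 0 hc le_rfl (by simpa using hs)).2
      refine ⟨f, fun i hi => ?_⟩
      rcases Finset.mem_insert.mp hi with rfl | hi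
      · have h1 : d * f (e i) = ∑ k ∈ s, c k * f (e k) := by
          simpa using congrArg f hd
        have h2 : 0 < ∑ k ∈ s, c k * f (e k) :=
          Finset.sum_pos' (fun k hk => mul_nonneg (hc k hk) (hf k hk).le)
            ⟨i₀, hi₀, mul_pos (lt_of_le_of_ne (hc i₀ hi₀) hci₀.symm) (hf i₀ hi₀)⟩
        exact pos_of_mul_pos_right (h1 ▸ h2) hdpos.le
      · exact hf i hi

/-- A family `b` satisfying all linear relations of a family `e` is the image of `e` under a
linear map. -/
theorem exists_linearMap_apply_eq {K : Type*} [Field K] {ι : Type*} [Fintype ι] {V W : Type*}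
    [AddCommGroup V] [Module K V] [AddCommGroup W] [Module K W] (e : ι → V) (b : ι → W)
    (h : ∀ c : ι → K, ∑ i, c i • e i = 0 → ∑ i, c i • b i = 0) :
    ∃ f : V →ₗ[K] W, ∀ i, f (e i) = b i := by
  classical
  set L := Fintype.linearCombination K e
  set B := Fintype.linearCombination K b
  obtain ⟨r, hr⟩ := L.rangeRestrict.exists_rightInverse_of_surjective L.range_rangeRestrict
  obtain ⟨f, hf⟩ := LinearMap.exists_extend (B ∘ₗ r)
  refine ⟨f, fun i => ?_⟩
  have he : L (Pi.single i 1) = e i := by simp [L]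
  have hb : B (Pi.single i 1) = b i := by simp [B]
  have h1 : f (L (Pi.single i 1)) = B (r (L.rangeRestrict (Pi.single i 1))) :=
    LinearMap.congr_fun hf (L.rangeRestrict (Pi.single i 1))
  have h2 : L (r (L.rangeRestrict (Pi.single i 1))) = L (Pi.single i 1) :=
    congrArg Subtype.val (LinearMap.congr_fun hr (L.rangeRestrict (Pi.single i 1)))
  have h3 : B (r (L.rangeRestrict (Pi.single i 1)) - Pi.single i 1) = 0 := by
    have h0 : L (r (L.rangeRestrict (Pi.single i 1)) - Pi.single i 1) = 0 := by
      rw [map_sub, h2, sub_self]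
    exact h _ h0
  rw [← he, h1, ← hb, ← sub_eq_zero, ← map_sub, h3]

section Relations

variable {ι V : Type*} [Fintype ι] [AddCommGroup V] [Module ℚ V] {e : ι → V} {z : ι → ℝ}

/-- Clearing denominators and separating signs in a rational relation. -/
theorem exists_nat_relation {c : ι → ℚ} (hc : ∑ i, c i • e i = 0) :
    ∃ (D : ℚ) (a b : ι → ℕ), 0 < D ∧ (∀ i, D * c i = a i - b i) ∧ (∀ i, a i = 0 ∨ b i = 0) ∧
      ∑ i, a i • e i = ∑ i, b i • e i := by
  obtain ⟨⟨D, hD⟩, hDc⟩ := IsLocalization.exist_integer_multiples_of_finite (nonZeroDivisors ℤ) c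
  choose k hk using hDc
  have hD0 : D ≠ 0 := nonZeroDivisors.ne_zero hD
  have hk' : ∀ i, (k i : ℚ) = D * c i := fun i => by simpa using hk i
  have hcast : ∀ m : ℤ, ((m.toNat : ℕ) : ℚ) - ((-m).toNat : ℕ) = m := fun m => by
    have := Int.toNat_sub_toNat_neg m
    exact_mod_cast this
  have hmul : ∀ i, |(D : ℚ)| * c i
      = (((D.sign * k i).toNat : ℕ) : ℚ) - ((-(D.sign * k i)).toNat : ℕ) := fun i => by
    rw [hcast, Int.cast_mul, hk', ← mul_assoc, ← Int.cast_mul, Int.sign_mul_self_eq_abs,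
      Int.cast_abs]
  refine ⟨|(D : ℚ)|, fun i => (D.sign * k i).toNat, fun i => (-(D.sign * k i)).toNat,
    abs_pos.mpr (by exact_mod_cast hD0), hmul, fun i => ?_, ?_⟩
  · rcases le_total (D.sign * k i) 0 with h | h
    · exact Or.inl (Int.toNat_of_nonpos h)
    · exact Or.inr (Int.toNat_of_nonpos (neg_nonpos.mpr h))
  rw [← sub_eq_zero, ← Finset.sum_sub_distrib]
  calc _ = ∑ i, (|(D : ℚ)| * c i) • e i := Finset.sum_congr rfl fun i _ => by
        rw [hmul, sub_smul, Nat.cast_smul_eq_nsmul, Nat.cast_smul_eq_nsmul]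
    _ = 0 := by simp_rw [mul_smul, ← Finset.smul_sum, hc, smul_zero]

/-- The data of a solution `z` of the binomial equations of a vector configuration
`e`: the support of `z` is cut out by a supporting functional, and on it `log z` (which stands
for `log |z|`) is linear. -/
theorem exists_face_of_binomial
    (hrel : ∀ a b : ι → ℕ, ∑ i, a i • e i = ∑ i, b i • e i → ∏ i, z i ^ a i = ∏ i, z i ^ b i) :
    ∃ (f : V →ₗ[ℚ] ℚ) (ψ : V →ₗ[ℚ] ℝ),
      (∀ i, z i ≠ 0 → f (e i) = 0 ∧ ψ (e i) = Real.log (z i)) ∧ ∀ i, z i = 0 → 0 < f (e i) := by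
  classical
  -- a relation that is nonnegative off the support of `z` is supported on it
  have hoff : ∀ c : ι → ℚ, ∑ i, c i • e i = 0 → (∀ i, z i = 0 → 0 ≤ c i) →
      ∀ i, z i = 0 → c i = 0 := by
    intro c hc hnn i hi
    obtain ⟨D, a, b, hD, hDc, hab, hsum⟩ := exists_nat_relation hc
    by_contra hci
    have hpos : 0 < D * c i := mul_pos hD (lt_of_le_of_ne (hnn i hi) (Ne.symm hci))
    have hai : a i ≠ 0 := fun h0 => by
      rw [hDc, h0] at hpos
      have : (0 : ℚ) ≤ b i := Nat.cast_nonneg _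
      push_cast at hpos
      linarith
    have h0 : ∏ i, z i ^ b i = 0 := by
      rw [← hrel a b hsum]
      exact Finset.prod_eq_zero (Finset.mem_univ i) (by rw [hi, zero_pow hai])
    obtain ⟨j, -, hj⟩ := Finset.prod_eq_zero_iff.mp h0
    obtain ⟨hzj, hbj⟩ := pow_eq_zero_iff'.mp hj
    have haj : a j = 0 := (hab j).resolve_right hbj
    have h1 := mul_nonneg hD.le (hnn j hzj)
    rw [hDc, haj] at h1
    have : (0 : ℚ) < b j := Nat.cast_pos.mpr (Nat.pos_of_ne_zero hbj)
    push_cast at h1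
    linarith
  -- a relation supported on the support of `z` is a relation between logarithms
  have hlog : ∀ c : ι → ℚ, ∑ i, c i • e i = 0 → (∀ i, z i = 0 → c i = 0) →
      ∑ i, c i • Real.log (z i) = 0 := by
    intro c hc hsupp
    obtain ⟨D, a, b, hD, hDc, hab, hsum⟩ := exists_nat_relation hc
    have hzero : ∀ i, z i = 0 → a i = 0 ∧ b i = 0 := fun i hi => by
      have h1 := hDc i
      rw [hsupp i hi, mul_zero, eq_comm, sub_eq_zero, Nat.cast_inj] at h1
      have := hab i
      omega
    have h1 := congrArg Real.log (hrel a b hsum)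
    rw [Real.log_prod fun i _ h0 => ?_, Real.log_prod fun i _ h0 => ?_] at h1
    · simp_rw [Real.log_pow] at h1
      have h2 : (D : ℝ) * ∑ i, c i • Real.log (z i) = 0 := by
        rw [Finset.mul_sum, ← sub_eq_zero.mpr h1, ← Finset.sum_sub_distrib]
        refine Finset.sum_congr rfl fun i _ => ?_
        have h3 : (D : ℝ) * c i = a i - b i := by exact_mod_cast hDc i
        rw [Rat.smul_def, ← mul_assoc, h3, sub_mul]
      exact (mul_eq_zero.mp h2).resolve_left (by exact_mod_cast hD.ne')
    · obtain ⟨hzi, hi⟩ := pow_eq_zero_iff'.mp h0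
      exact hi (hzero i hzi).2
    · obtain ⟨hzi, hi⟩ := pow_eq_zero_iff'.mp h0
      exact hi (hzero i hzi).1
  set e' : ι → V := fun i => if z i = 0 then 0 else e i with he'
  obtain ⟨ψ, hψ⟩ := exists_linearMap_apply_eq (K := ℚ) e' (fun i => Real.log (z i)) fun c hc => by
    have := hlog (fun i => if z i = 0 then 0 else c i) ?_ fun i hi => if_pos hi
    · rw [← this]
      refine Finset.sum_congr rfl fun i _ => ?_
      -- off the support of `z` this uses the junk value `log 0 = 0`
      by_cases hi : z i = 0 <;> simp [hi]
    · rw [← hc]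
      refine Finset.sum_congr rfl fun i _ => ?_
      by_cases hi : z i = 0 <;> simp [he', hi]
  obtain ⟨f, hf⟩ := exists_dual_forall_pos (K := ℚ) {i | z i = 0}
    (fun i => (Submodule.span ℚ (Set.range e')).mkQ (e i)) fun c hc hsum i hi => by
      simp_rw [← map_smul, ← map_sum] at hsum
      obtain ⟨d, hd⟩ := Submodule.mem_span_range_iff_exists_fun ℚ |>.mp
        ((Submodule.Quotient.mk_eq_zero _).mp hsum)
      have h0 := hoff (fun i => if z i = 0 then c i else -d i) ?_ ?_ i (by simpa using hi)
      · simpa [show z i = 0 by simpa using hi] using h0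
      · rw [Finset.sum_filter, ← sub_eq_zero, ← Finset.sum_sub_distrib] at hd
        rw [← neg_eq_zero, ← hd, ← Finset.sum_neg_distrib]
        refine Finset.sum_congr rfl fun i _ => ?_
        by_cases hi : z i = 0 <;> simp [he', hi]
      · intro i hi
        simpa [hi] using hc i (by simpa using hi)
  refine ⟨f ∘ₗ (Submodule.span ℚ (Set.range e')).mkQ, ψ, fun i hi => ⟨?_, ?_⟩, fun i hi => ?_⟩
  · have : (Submodule.span ℚ (Set.range e')).mkQ (e i) = 0 :=
      (Submodule.Quotient.mk_eq_zero _).mpr (Submodule.subset_span ⟨i, by simp [he', hi]⟩)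
    rw [LinearMap.comp_apply, this, map_zero]
  · simpa [he', hi] using hψ i
  · exact hf i (by simpa using hi)

end Relations

/-! ### Generators of `A(g)` -/

section Generators

variable {n : ℕ} {g : MvPolynomial (Fin n) ℝ}

open MvPolynomial IsLocalization.Away

theorem algebraMap_mem_semiringAway {f : MvPolynomial (Fin n) ℝ} (hf : f ∈ nonnegPoly n) :
    algebraMap (MvPolynomial (Fin n) ℝ) (Localization.Away g) f ∈ semiringAway g :=
  Subsemiring.subset_closure (Or.inl ⟨f, hf, rfl⟩)

theorem invSelf_mem_semiringAway :
    (invSelf g : Localization.Away g) ∈ semiringAway g :=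
  Subsemiring.subset_closure (Or.inr rfl)

theorem monomial_mem_nonnegPoly (m : Fin n →₀ ℕ) {r : ℝ} (hr : 0 ≤ r) :
    monomial m r ∈ nonnegPoly n := fun m' => by
  classical
  rw [coeff_monomial]
  split_ifs <;> simp [hr]

theorem algebraMap_C_mem_handelmanRing (r : ℝ) :
    algebraMap (MvPolynomial (Fin n) ℝ) (Localization.Away g) (C r) ∈ handelmanRing g := by
  obtain ⟨N, hN⟩ := exists_nat_ge |r|
  refine ⟨N, ?_, ?_⟩
  · have := algebraMap_mem_semiringAway (g := g)
      (monomial_mem_nonnegPoly 0 (show 0 ≤ (N : ℝ) + r by linarith [neg_abs_le r]))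
    simpa only [monomial_zero', map_add, map_natCast] using this
  · have := algebraMap_mem_semiringAway (g := g)
      (monomial_mem_nonnegPoly 0 (show 0 ≤ (N : ℝ) - r by linarith [le_abs_self r]))
    simpa only [monomial_zero', map_sub, map_natCast] using this

/-- The quotient `X ^ m / g`. -/
noncomputable def monomialDiv (g : MvPolynomial (Fin n) ℝ) (m : Fin n →₀ ℕ) : Localization.Away g :=
  algebraMap (MvPolynomial (Fin n) ℝ) _ (monomial m 1) * invSelf g

theorem monomialDiv_mem_semiringAway (m : Fin n →₀ ℕ) : monomialDiv g m ∈ semiringAway g :=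
  Subsemiring.mul_mem _ (algebraMap_mem_semiringAway (monomial_mem_nonnegPoly m zero_le_one))
    invSelf_mem_semiringAway

theorem monomialDiv_mem_handelmanRing (hg : g ∈ nonnegPoly n) {m : Fin n →₀ ℕ}
    (hm : m ∈ g.support) : monomialDiv g m ∈ handelmanRing g := by
  classical
  have hpos : 0 < g.coeff m := lt_of_le_of_ne (hg m) (Ne.symm (mem_support_iff.mp hm))
  obtain ⟨N, hN⟩ := exists_nat_ge (g.coeff m)⁻¹
  refine ⟨N, Subsemiring.add_mem _ (natCast_mem _ N) (monomialDiv_mem_semiringAway m), ?_⟩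
  have hmem : (N : MvPolynomial (Fin n) ℝ) * g - monomial m 1 ∈ nonnegPoly n := fun m' => by
    rw [coeff_sub, ← map_natCast (C : ℝ →+* MvPolynomial (Fin n) ℝ), coeff_C_mul, coeff_monomial]
    split_ifs with h
    · subst h
      rw [sub_nonneg]
      calc (1 : ℝ) = (g.coeff m)⁻¹ * g.coeff m := (inv_mul_cancel₀ hpos.ne').symm
        _ ≤ N * g.coeff m := mul_le_mul_of_nonneg_right hN hpos.le
    · rw [sub_zero]
      exact mul_nonneg (Nat.cast_nonneg _) (hg m')
  convert Subsemiring.mul_mem _ (algebraMap_mem_semiringAway (g := g) hmem)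
    invSelf_mem_semiringAway using 1
  rw [map_sub, map_mul, map_natCast, sub_mul, mul_assoc, mul_invSelf, mul_one, monomialDiv]

/-- The elements of `T_g` are the quotients `f / g ^ k` with `f ∈ ℝ≥0[X]`. -/
theorem exists_mul_pow_eq_of_mem_semiringAway (hg : g ∈ nonnegPoly n) {a : Localization.Away g}
    (ha : a ∈ semiringAway g) :
    ∃ k : ℕ, ∀ l, k ≤ l → ∃ f ∈ nonnegPoly n,
      a * algebraMap (MvPolynomial (Fin n) ℝ) _ g ^ l =
        algebraMap (MvPolynomial (Fin n) ℝ) _ f := by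
  suffices h : ∃ k : ℕ, ∃ f ∈ nonnegPoly n,
      a * algebraMap (MvPolynomial (Fin n) ℝ) _ g ^ k = algebraMap (MvPolynomial (Fin n) ℝ) _ f by
    obtain ⟨k, f, hf, h⟩ := h
    refine ⟨k, fun l hl => ⟨f * g ^ (l - k), mul_mem hf (pow_mem hg _), ?_⟩⟩
    rw [map_mul, ← h, map_pow, mul_assoc, ← pow_add, Nat.add_sub_cancel' hl]
  induction ha using Subsemiring.closure_induction with
  | mem a ha =>
    rcases ha with ⟨f, hf, rfl⟩ | rfl
    · exact ⟨0, f, hf, by simp⟩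
    · exact ⟨1, 1, one_mem _, by rw [pow_one, mul_comm, mul_invSelf, map_one]⟩
  | zero => exact ⟨0, 0, zero_mem _, by simp⟩
  | one => exact ⟨0, 1, one_mem _, by simp⟩
  | add a b _ _ iha ihb =>
    obtain ⟨k, f, hf, h⟩ := iha
    obtain ⟨l, f', hf', h'⟩ := ihb
    refine ⟨k + l, f * g ^ l + f' * g ^ k,
      add_mem (mul_mem hf (pow_mem hg _)) (mul_mem hf' (pow_mem hg _)), ?_⟩
    rw [map_add, map_mul, map_mul, ← h, ← h', map_pow, map_pow]
    ring
  | mul a b _ _ iha ihb =>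
    obtain ⟨k, f, hf, h⟩ := iha
    obtain ⟨l, f', hf', h'⟩ := ihb
    refine ⟨k + l, f * f', mul_mem hf hf', ?_⟩
    rw [map_mul, ← h, ← h']
    ring

/-- An element of `A(g)` is a quotient `f / g ^ k` in which every monomial of `f` occurs in
`g ^ k`: if `N ± a` have numerators `f₁, f₂ ∈ ℝ≥0[X]` over `g ^ k`, then `f₁ + f₂ = 2 N g ^ k`
and no cancellation takes place on the left. -/
theorem exists_eq_of_mem_handelmanRing (hg : g ∈ nonnegPoly n) (hg0 : g ≠ 0)
    {a : Localization.Away g} (ha : a ∈ handelmanRing g) :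
    ∃ (k : ℕ) (f : MvPolynomial (Fin n) ℝ), f.support ⊆ (g ^ k).support ∧
      a = algebraMap (MvPolynomial (Fin n) ℝ) _ f * invSelf g ^ k := by
  obtain ⟨N, h1, h2⟩ := ha
  obtain ⟨k₁, hk₁⟩ := exists_mul_pow_eq_of_mem_semiringAway hg h1
  obtain ⟨k₂, hk₂⟩ := exists_mul_pow_eq_of_mem_semiringAway hg h2
  obtain ⟨f₁, hf₁, he₁⟩ := hk₁ (max k₁ k₂) (le_max_left _ _)
  obtain ⟨f₂, hf₂, he₂⟩ := hk₂ (max k₁ k₂) (le_max_right _ _)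
  set k := max k₁ k₂
  have hinj : Function.Injective (algebraMap (MvPolynomial (Fin n) ℝ) (Localization.Away g)) :=
    IsLocalization.injective _ (powers_le_nonZeroDivisors_of_noZeroDivisors hg0)
  have hsum : f₁ + f₂ = C (2 * N : ℝ) * g ^ k := hinj (by
    rw [map_add, ← he₁, ← he₂, map_mul, map_pow, C_mul, map_mul]
    simp only [map_natCast, map_ofNat]
    ring)
  refine ⟨k, f₁ - C (N : ℝ) * g ^ k, fun m hm => ?_, ?_⟩
  · rw [mem_support_iff] at hm ⊢
    intro h0
    have h3 := congrArg (coeff m) hsum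
    rw [coeff_add, coeff_C_mul, h0, mul_zero] at h3
    have h4 : coeff m f₁ = 0 := by linarith [hf₁ m, hf₂ m]
    rw [coeff_sub, coeff_C_mul, h4, h0, mul_zero, sub_zero] at hm
    exact hm rfl
  · rw [map_sub, ← he₁, map_mul, map_pow, map_natCast, map_natCast, ← sub_mul, add_sub_cancel_left,
      mul_assoc, ← mul_pow, mul_invSelf, one_pow, mul_one]

/-- `A(g)` is generated by `ℝ` and the quotients `X ^ m / g`, for `m` in the support of `g`. -/
theorem handelmanRing_le_closure (hg : g ∈ nonnegPoly n) (hg0 : g ≠ 0) :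
    handelmanRing g ≤ Subring.closure
      (Set.range (fun r : ℝ => algebraMap (MvPolynomial (Fin n) ℝ) (Localization.Away g) (C r)) ∪
        monomialDiv g '' g.support) := by
  classical
  intro a ha
  obtain ⟨k, f, hf, rfl⟩ := exists_eq_of_mem_handelmanRing hg hg0 ha
  have key : ∀ (k : ℕ) (m : Fin n →₀ ℕ), m ∈ (g ^ k).support →
      algebraMap (MvPolynomial (Fin n) ℝ) (Localization.Away g) (monomial m 1) * invSelf g ^ k ∈
        Subring.closure (Set.range (fun r : ℝ =>
          algebraMap (MvPolynomial (Fin n) ℝ) (Localization.Away g) (C r)) ∪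
          monomialDiv g '' g.support) := by
    intro k
    induction k with
    | zero =>
      intro m hm
      rw [pow_zero, mem_support_iff, coeff_one] at hm
      obtain rfl : 0 = m := by
        by_contra h
        simp [h] at hm
      simp
    | succ k ih =>
      intro m hm
      rw [pow_succ] at hm
      obtain ⟨m₁, h₁, m₂, h₂, rfl⟩ := Finset.mem_add.mp (support_mul _ _ hm)
      convert mul_mem (ih m₁ h₁) (Subring.subset_closure (Or.inr ⟨m₂, h₂, rfl⟩)) using 1
      rw [monomialDiv, ← mul_one (1 : ℝ), ← monomial_mul, map_mul, mul_one, pow_succ]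
      ring
  rw [f.as_sum, map_sum, Finset.sum_mul]
  refine sum_mem fun m hm => ?_
  rw [← mul_one (coeff m f), ← C_mul_monomial, map_mul, mul_assoc]
  exact mul_mem (Subring.subset_closure (Or.inl ⟨_, rfl⟩)) (key k m (hf hm))

theorem prod_monomialDiv_pow {ι : Type*} (s : Finset ι) (e : ι → Fin n →₀ ℕ) (a : ι → ℕ) :
    ∏ i ∈ s, monomialDiv g (e i) ^ a i =
      algebraMap (MvPolynomial (Fin n) ℝ) _ (monomial (∑ i ∈ s, a i • e i) 1) *
        invSelf g ^ ∑ i ∈ s, a i := by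
  simp_rw [monomialDiv, mul_pow, Finset.prod_mul_distrib, Finset.prod_pow_eq_pow_sum]
  rw [monomial_sum_one, map_prod]
  simp_rw [← map_pow, monomial_pow, one_pow]

theorem sum_coeff_mul_monomialDiv :
    ∑ m ∈ g.support, algebraMap (MvPolynomial (Fin n) ℝ) _ (C (g.coeff m)) * monomialDiv g m
      = 1 := by
  simp_rw [monomialDiv, ← mul_assoc, ← map_mul, C_mul_monomial, mul_one, ← Finset.sum_mul,
    ← map_sum]
  rw [← g.as_sum, mul_invSelf]

end Generators

/-! ### Limits along one-parameter curves -/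

section Limits

variable {n : ℕ} {g : MvPolynomial (Fin n) ℝ}

open MvPolynomial

/-- The exponent vector of a monomial, made homogeneous by a last coordinate `1`, so that affine
relations between exponents become linear ones. -/
noncomputable def homogenizedExponent (m : Fin n →₀ ℕ) : (Fin n → ℚ) × ℚ :=
  (fun j => (m j : ℚ), 1)

theorem map_homogenizedExponent (ψ : (Fin n → ℚ) × ℚ →ₗ[ℚ] ℝ) (m : Fin n →₀ ℕ) :
    ψ (homogenizedExponent m) = ∑ j, (m j : ℝ) * ψ (Pi.single j 1, 0) + ψ (0, 1) := by
  have h : homogenizedExponent m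
      = ∑ j, (m j : ℚ) • ((Pi.single j 1, 0) : (Fin n → ℚ) × ℚ) + (0, 1) := by
    refine Prod.ext ?_ ?_
    · ext i
      simp [homogenizedExponent, Prod.fst_sum, Finset.sum_apply, Pi.single_apply]
    · simp [homogenizedExponent, Prod.snd_sum]
  rw [h, map_add, map_sum]
  congr 1
  refine Finset.sum_congr rfl fun j _ => ?_
  rw [map_smul, Rat.smul_def, Rat.cast_natCast]

theorem evalAway_algebraMap (hg : g ∈ nonnegPoly n) (hg0 : g ≠ 0) {p : Fin n → ℝ}
    (hp : ∀ i, 0 < p i) (f : MvPolynomial (Fin n) ℝ) :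
    evalAway hg hg0 p hp (algebraMap (MvPolynomial (Fin n) ℝ) _ f) = eval p f :=
  IsLocalization.Away.lift_eq _ _ _

theorem evalAway_monomialDiv (hg : g ∈ nonnegPoly n) (hg0 : g ≠ 0) {p : Fin n → ℝ}
    (hp : ∀ i, 0 < p i) (m : Fin n →₀ ℕ) :
    evalAway hg hg0 p hp (monomialDiv g m) = (∏ j, p j ^ m j) / eval p g := by
  rw [eq_div_iff (eval_pos_of_nonnegPoly hg hg0 hp).ne', ← evalAway_algebraMap hg hg0 hp g,
    ← map_mul, monomialDiv, mul_assoc, mul_comm _ (algebraMap (MvPolynomial (Fin n) ℝ) _ g),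
    IsLocalization.Away.mul_invSelf, mul_one, evalAway_algebraMap, eval_monomial, one_mul,
    Finsupp.prod_fintype _ _ fun _ => pow_zero _]

/-- The values of a ring homomorphism `A(g) → ℝ` at the quotients `X ^ m / g` satisfy the binomial
equations given by the relations between the exponents. -/
theorem prod_map_monomialDiv_eq (x : handelmanRing g →+* ℝ) (u : g.support → handelmanRing g)
    (hu : ∀ i, (u i : Localization.Away g) = monomialDiv g i) (a b : g.support → ℕ)
    (h : ∑ i, a i • homogenizedExponent (i : Fin n →₀ ℕ) = ∑ i, b i • homogenizedExponent i.1) :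
    ∏ i, x (u i) ^ a i = ∏ i, x (u i) ^ b i := by
  have h1 : ∑ i, a i = ∑ i, b i := by
    have := congrArg Prod.snd h
    simp only [homogenizedExponent, Prod.snd_sum, Prod.smul_mk, nsmul_eq_mul, mul_one] at this
    exact_mod_cast this
  have h2 : ∑ i, a i • (i : Fin n →₀ ℕ) = ∑ i, b i • (i : Fin n →₀ ℕ) := by
    ext j
    have := congrFun (congrArg Prod.fst h) j
    simp only [homogenizedExponent, Prod.fst_sum, Prod.smul_mk, Finset.sum_apply,
      Pi.smul_apply] at this
    simp only [nsmul_eq_mul] at this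
    simp only [Finsupp.finsetSum_apply, Finsupp.smul_apply, smul_eq_mul]
    exact_mod_cast this
  simp_rw [← map_pow, ← map_prod]
  congr 1
  apply Subtype.ext
  push_cast
  simp_rw [hu]
  rw [prod_monomialDiv_pow, prod_monomialDiv_pow, h1, h2]

/-- Along a curve `e ^ {t w} y` whose direction `w` and base point `y` come from functionals `f`
and `ψ` as in `exists_face_of_binomial`, the quotient `X ^ m / g` tends to `z m`. -/
theorem tendsto_evalAway_monomialDiv (hg : g ∈ nonnegPoly n) (hg0 : g ≠ 0)
    {z : (Fin n →₀ ℕ) → ℝ} (hz : ∀ m ∈ g.support, 0 ≤ z m)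
    (hz1 : ∑ m ∈ g.support, g.coeff m * z m = 1) {f ψ : (Fin n → ℚ) × ℚ →ₗ[ℚ] ℝ}
    (hpos : ∀ m ∈ g.support, z m ≠ 0 →
      f (homogenizedExponent m) = 0 ∧ ψ (homogenizedExponent m) = Real.log (z m))
    (hzero : ∀ m ∈ g.support, z m = 0 → 0 < f (homogenizedExponent m))
    {m : Fin n →₀ ℕ} (hm : m ∈ g.support) :
    Tendsto (fun t : ℝ => evalAway hg hg0
        (fun j => Real.exp (t * -f (Pi.single j 1, 0)) * Real.exp (ψ (Pi.single j 1, 0)))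
        (fun _ => mul_pos (Real.exp_pos _) (Real.exp_pos _)) (monomialDiv g m))
      atTop (𝓝 (z m)) := by
  set E : (Fin n →₀ ℕ) → ℝ → ℝ := fun m t =>
    Real.exp (-t * f (homogenizedExponent m) + ψ (homogenizedExponent m)) with hE
  have hprod : ∀ (m : Fin n →₀ ℕ) (t : ℝ),
      ∏ j, (Real.exp (t * -f (Pi.single j 1, 0)) * Real.exp (ψ (Pi.single j 1, 0))) ^ m j
        = Real.exp (t * f (0, 1) - ψ (0, 1)) * E m t := by
    intro m t
    simp_rw [hE, ← Real.exp_add, ← Real.exp_nat_mul, ← Real.exp_sum, map_homogenizedExponent]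
    congr 1
    simp_rw [mul_add, Finset.sum_add_distrib, Finset.mul_sum]
    have : ∑ j, (m j : ℝ) * (t * -f (Pi.single j 1, 0))
        = ∑ j, -t * ((m j : ℝ) * f (Pi.single j 1, 0)) :=
      Finset.sum_congr rfl fun j _ => by ring
    rw [this]
    ring
  have hlim : ∀ m ∈ g.support, Tendsto (E m) atTop (𝓝 (z m)) := by
    intro m hm
    by_cases h0 : z m = 0
    · rw [h0]
      refine Real.tendsto_exp_atBot.comp (tendsto_atBot_add_const_right _ _ ?_)
      exact tendsto_neg_atTop_atBot.atBot_mul_const (hzero m hm h0)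
    · obtain ⟨h1, h2⟩ := hpos m hm h0
      have : E m = fun _ => z m := by
        funext t
        simp only [hE]
        rw [h1, h2, mul_zero, zero_add, Real.exp_log (lt_of_le_of_ne (hz m hm) (Ne.symm h0))]
      rw [this]
      exact tendsto_const_nhds
  have hquot : Tendsto (fun t => E m t / ∑ m' ∈ g.support, g.coeff m' * E m' t) atTop
      (𝓝 (z m)) := by
    have h := (hlim m hm).div
      (tendsto_finsetSum _ fun m' hm' => (hlim m' hm').const_mul (g.coeff m'))
      (by rw [hz1]; exact one_ne_zero)
    rwa [hz1, div_one] at h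
  refine hquot.congr fun t => ?_
  rw [evalAway_monomialDiv, eval_eq', hprod]
  simp_rw [hprod, mul_left_comm (g.coeff _) (Real.exp _)]
  rw [← Finset.mul_sum, mul_div_mul_left _ _ (Real.exp_pos _).ne']

end Limits

theorem corollary4p2 {n : ℕ} (g : MvPolynomial (Fin n) ℝ) (hg : g ∈ nonnegPoly n) (hg0 : g ≠ 0)
    (x : handelmanRing g →+* ℝ) (hx : x ∈ realPoints (handelmanSemiring g)) :
    ∃ (w y : Fin n → ℝ) (hy : ∀ i, 0 < y i), ∀ a : handelmanRing g,
      Tendsto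
        (fun t : ℝ => evalAway hg hg0 (fun i => Real.exp (t * w i) * y i)
          (fun i => mul_pos (Real.exp_pos _) (hy i)) (a : Localization.Away g))
        atTop (𝓝 (x a)) := by
  classical
  set u : g.support → handelmanRing g := fun i =>
    ⟨monomialDiv g i, monomialDiv_mem_handelmanRing hg i.2⟩
  have hxC : ∀ r : ℝ, x ⟨_, algebraMap_C_mem_handelmanRing r⟩ = r := fun r => by
    -- `ℝ` has no ring endomorphism but the identity
    have h := RingHom.congr_fun (Subsingleton.elim (x.comp
      (((algebraMap (MvPolynomial (Fin n) ℝ) (Localization.Away g)).comp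
        MvPolynomial.C).codRestrict (handelmanRing g)
        algebraMap_C_mem_handelmanRing)) (RingHom.id ℝ)) r
    exact h
  set z : (Fin n →₀ ℕ) → ℝ := fun m => if h : m ∈ g.support then x (u ⟨m, h⟩) else 0
  have hzu : ∀ i : g.support, z i = x (u i) := fun i => dif_pos i.2
  have hz0 : ∀ m ∈ g.support, 0 ≤ z m := fun m hm => by
    rw [hzu ⟨m, hm⟩]
    exact hx _ (monomialDiv_mem_semiringAway m)
  have hz1 : ∑ m ∈ g.support, g.coeff m * z m = 1 := by
    rw [← Finset.sum_coe_sort]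
    simp_rw [hzu]
    have h : ∑ i : g.support, (⟨_, algebraMap_C_mem_handelmanRing (g.coeff i)⟩ : handelmanRing g)
        * u i = 1 := by
      apply Subtype.ext
      push_cast
      rw [← sum_coeff_mul_monomialDiv (g := g), ← Finset.sum_coe_sort g.support]
    have h' := congrArg x h
    rw [map_sum, map_one] at h'
    simpa only [map_mul, hxC] using h'
  obtain ⟨f, ψ, hpos, hzero⟩ := exists_face_of_binomial
    (e := fun i : g.support => homogenizedExponent (i : Fin n →₀ ℕ)) (z := fun i => z i)
    fun a b hab => by
      simp_rw [hzu]
      exact prod_map_monomialDiv_eq x u (fun _ => rfl) a b hab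
  refine ⟨fun j => -(f (Pi.single j 1, 0) : ℝ), fun j => Real.exp (ψ (Pi.single j 1, 0)),
    fun _ => Real.exp_pos _, ?_⟩
  have hgen := fun m (hm : m ∈ g.support) => tendsto_evalAway_monomialDiv hg hg0 hz0 hz1
    (f := Algebra.linearMap ℚ ℝ ∘ₗ f) (ψ := ψ)
    (fun m hm h => ⟨by simp [(hpos ⟨m, hm⟩ h).1], (hpos ⟨m, hm⟩ h).2⟩)
    (fun m hm h => by simpa using hzero ⟨m, hm⟩ h) hm
  rintro ⟨a, ha⟩
  -- the closure is contained in `A(g)`, so that `x` makes sense on its elements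
  have hle : Subring.closure
      (Set.range (fun r : ℝ =>
          algebraMap (MvPolynomial (Fin n) ℝ) (Localization.Away g) (MvPolynomial.C r)) ∪
        monomialDiv g '' g.support) ≤ handelmanRing g := by
    rw [Subring.closure_le]
    rintro _ (⟨r, rfl⟩ | ⟨m, hm, rfl⟩)
    · exact algebraMap_C_mem_handelmanRing r
    · exact monomialDiv_mem_handelmanRing hg hm
  have hmem := handelmanRing_le_closure hg hg0 ha
  induction hmem using Subring.closure_induction with
  | mem b hb =>
    rcases hb with ⟨r, rfl⟩ | ⟨m, hm, rfl⟩
    · rw [hxC]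
      simp only [evalAway_algebraMap, MvPolynomial.eval_C]
      exact tendsto_const_nhds
    · have h := hgen m hm
      rw [hzu ⟨m, hm⟩] at h
      simpa using h
  | zero =>
    rw [show x ⟨0, ha⟩ = 0 from map_zero x]
    simp
  | one =>
    rw [show x ⟨1, ha⟩ = 1 from map_one x]
    simp
  | add b c hb hc ihb ihc =>
    rw [show x ⟨b + c, ha⟩ = x ⟨b, hle hb⟩ + x ⟨c, hle hc⟩ from map_add x ⟨b, _⟩ ⟨c, _⟩]
    simpa only [map_add] using (ihb (hle hb)).add (ihc (hle hc))
  | neg b hb ihb =>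
    rw [show x ⟨-b, ha⟩ = -x ⟨b, hle hb⟩ from map_neg x ⟨b, _⟩]
    simpa only [map_neg] using (ihb (hle hb)).neg
  | mul b c hb hc ihb ihc =>
    rw [show x ⟨b * c, ha⟩ = x ⟨b, hle hb⟩ * x ⟨c, hle hc⟩ from map_mul x ⟨b, _⟩ ⟨c, _⟩]
    simpa only [map_mul] using (ihb (hle hb)).mul (ihc (hle hc))
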